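/- **Theorem (LSTM upper bound).** Let $\Sigma$ be a finite alphabet and $k\in\mathbb N$. Write $\sigma(z)=1/(1+e^{-z})$. An LSTM acceptor with $k$ units and real parameters $\theta=(W^g,U^g,b^g)_{g\in\{f,i,o,c\}},\,w,\,\beta$ reads a word $a_1\cdots a_n\in\Sigma^*$, encoded by one-hot vectors $x_1,\dots,x_n$, starts from $c_0=h_0=0\in\mathbb R^k$, and computes for $1\le t\le n$ $$f_t=\sigma(W^f x_t+U^f h_{t-1}+b^f),\quad i_t=\sigma(W^i x_t+U^i h_{t-1}+b^i),\quad o_t=\sigma(W^o x_t+U^o h_{t-1}+b^o),$$ $$\tilde c_t=\tanh(W^c x_t+U^c h_{t-1}+b^c),\qquad c_t=f_t\odot c_{t-1}+i_t\odot\tilde c_t,\qquad h_t=o_t\odot \phi(c_t),$$ where $\phi$ is either the identity or $\tanh$ (applied entrywise, as is $\sigma$). Its output on the word is $p^\theta(a_1\cdots a_n)=\sigma(w\cdot h_n+\beta)\in(0,1)$. It *asymptotically accepts* a language $L\subseteq\Sigma^*$ if $\lim_{N\to\infty}p^{N\theta}(u)=\mathbb 1_L(u)$ for every $u\in\Sigma^*$,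 where $N\theta$ denotes all parameters multiplied by $N$. Assume that no forget gate is asymptotically undecided, that is, for every word, every time step $t$ and every coordinate $j$, the number $[f_t]_j$ computed with parameters $N\theta$ does not converge to $\tfrac12=\sigma(0)$ as $N\to\infty$. A *real-time machine* has a string of bits as its memory, a fixed initial memory, an arbitrary update function that computes the new memory from the old memory and the current input symbol and is applied exactly once per input symbol, and a set of accepting memories; it accepts the words after which its memory is accepting. A language is *real-time log-space* (belongs to $\mathrm{CL}$) if it is the language of a real-time machine whose memory, after any $n$ input symbols, holds $O(\log n)$ bits, i.e. at most $C(\lfloor\log_2 n\rfloor+1)$ bits for a constant $C$ (with $\lfloor\log_2 0\rfloor$ read as $0$). Then every language that is asymptotically accepted by such an LSTM acceptor belongs to $\mathrm{CL}$; that is, $L(\mathrm{LSTM})\subseteq\mathrm{CL}$. -/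

import Mathlib

open Filter Topology

noncomputable section

/-- The activation applied to the cell state in an LSTM layer: the identity or `tanh`. -/
inductive CellActivation where
  | identity
  | tanh

/-- The real function denoted by a cell activation. -/
def CellActivation.toFun : CellActivation → ℝ → ℝ
  | .identity => fun x => x
  | .tanh => Real.tanh

/-- The weights `(W, U, b)` of one of the four affine maps `W x + U h + b` of an LSTM layer with
`k` units that reads one-hot vectors over the alphabet `α`. -/
structure AffineWeights (α : Type*) (k : ℕ) where
  W : Matrix (Fin k) α ℝ
  U : Matrix (Fin k) (Fin k) ℝ
  b : Fin k → ℝ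

/-- The vector `W x + U h + b`. -/
def AffineWeights.eval {α : Type*} [Fintype α] {k : ℕ} (A : AffineWeights α k)
    (x : α → ℝ) (h : Fin k → ℝ) : Fin k → ℝ :=
  A.W.mulVec x + A.U.mulVec h + A.b

/-- All weights multiplied by `N`. -/
def AffineWeights.scale {α : Type*} {k : ℕ} (N : ℝ) (A : AffineWeights α k) :
    AffineWeights α k :=
  ⟨N • A.W, N • A.U, N • A.b⟩

/-- The parameters `θ` of an LSTM acceptor with `k` units: the weights of the forget gate, the
input gate, the output gate and the candidate update, and those of a final sigmoid unit. -/
structure LSTMWeights (α : Type*) (k : ℕ) where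
  forget : AffineWeights α k
  input : AffineWeights α k
  output : AffineWeights α k
  candidate : AffineWeights α k
  headW : Fin k → ℝ
  headB : ℝ

/-- The parameters `N θ`. -/
def LSTMWeights.scale {α : Type*} {k : ℕ} (N : ℝ) (θ : LSTMWeights α k) : LSTMWeights α k where
  forget := θ.forget.scale N
  input := θ.input.scale N
  output := θ.output.scale N
  candidate := θ.candidate.scale N
  headW := N • θ.headW
  headB := N * θ.headB

/-- The state of an LSTM layer: the cell state `c` and the output `h`. -/
structure LSTMState (k : ℕ) where
  c : Fin k → ℝ
  h : Fin k → ℝ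

namespace LSTMWeights

variable {α : Type*} [Fintype α] [DecidableEq α] {k : ℕ}

/-- The forget gate `f_t = σ(W^f x_t + U^f h_{t-1} + b^f)`, where `x_t` is the one-hot vector of
the symbol `a` and `h_{t-1}` is the vector `h`. -/
def forgetGate (θ : LSTMWeights α k) (h : Fin k → ℝ) (a : α) : Fin k → ℝ :=
  fun j => Real.sigmoid (θ.forget.eval (Pi.single a 1) h j)

/-- The input gate `i_t`. -/
def inputGate (θ : LSTMWeights α k) (h : Fin k → ℝ) (a : α) : Fin k → ℝ :=
  fun j => Real.sigmoid (θ.input.eval (Pi.single a 1) h j)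

/-- The output gate `o_t`. -/
def outputGate (θ : LSTMWeights α k) (h : Fin k → ℝ) (a : α) : Fin k → ℝ :=
  fun j => Real.sigmoid (θ.output.eval (Pi.single a 1) h j)

/-- The candidate update `tanh(W^c x_t + U^c h_{t-1} + b^c)`. -/
def candidateUpdate (θ : LSTMWeights α k) (h : Fin k → ℝ) (a : α) : Fin k → ℝ :=
  fun j => Real.tanh (θ.candidate.eval (Pi.single a 1) h j)

/-- The new cell state `c_t`, the sum of the entrywise products of the forget gate with `c_{t-1}`
and of the input gate with the candidate update. -/
def nextCell (θ : LSTMWeights α k) (s : LSTMState k) (a : α) : Fin k → ℝ :=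
  fun j => θ.forgetGate s.h a j * s.c j + θ.inputGate s.h a j * θ.candidateUpdate s.h a j

/-- One time step of the LSTM layer with cell activation `f`. -/
def step (f : CellActivation) (θ : LSTMWeights α k) (s : LSTMState k) (a : α) : LSTMState k where
  c := θ.nextCell s a
  h := fun j => θ.outputGate s.h a j * f.toFun (θ.nextCell s a j)

/-- The state of the LSTM layer after the word `w` has been read, from the initial state
`c_0 = 0`, `h_0 = 0`. -/
def state (f : CellActivation) (θ : LSTMWeights α k) (w : List α) : LSTMState k :=
  w.foldl (θ.step f) ⟨0, 0⟩

/-- The output probability `σ(headW ⬝ h_n + headB)` of the LSTM acceptor on the word `w`. -/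
def prob (f : CellActivation) (θ : LSTMWeights α k) (w : List α) : ℝ :=
  Real.sigmoid (dotProduct θ.headW (θ.state f w).h + θ.headB)

open Classical in
/-- `θ` asymptotically accepts `L`: as `N → ∞`, the output probabilities of the acceptors with
parameters `N θ` converge pointwise to the indicator function of `L`. -/
def AsymptoticallyAccepts (f : CellActivation) (θ : LSTMWeights α k) (L : Language α) : Prop :=
  ∀ w : List α,
    Tendsto (fun N : ℝ => (θ.scale N).prob f w) atTop (𝓝 (if w ∈ L then 1 else 0))

/-- No forget gate is asymptotically undecided: at no time step of no computation does a
coordinate of the forget gate converge to `1 / 2 = σ(0)`. Here `w` is the word that has been read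
before the time step and `a` is the symbol that is read in it. -/
def ForgetGatesDecided (f : CellActivation) (θ : LSTMWeights α k) : Prop :=
  ∀ (w : List α) (a : α) (j : Fin k),
    ¬ Tendsto (fun N : ℝ => (θ.scale N).forgetGate ((θ.scale N).state f w).h a j) atTop
      (𝓝 (1 / 2))

end LSTMWeights

/-- A real-time machine over the alphabet `α`. Its memory is a string of bits, it is updated
exactly once for each input symbol, and the decision is read off the memory after the last
symbol. -/
structure RealTimeMachine (α : Type*) where
  init : List Bool
  update : List Bool → α → List Bool
  accept : Set (List Bool)

namespace RealTimeMachine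

variable {α : Type*}

/-- The contents of the memory after the word `w` has been read. -/
def memory (M : RealTimeMachine α) (w : List α) : List Bool :=
  w.foldl M.update M.init

/-- The language of the words that the machine accepts. -/
def language (M : RealTimeMachine α) : Language α :=
  {w | M.memory w ∈ M.accept}

/-- After any `n` input symbols the memory holds `O(log n)` bits. -/
def IsLogSpace (M : RealTimeMachine α) : Prop :=
  ∃ C : ℕ, ∀ w : List α, (M.memory w).length ≤ C * (Nat.log 2 w.length + 1)

end RealTimeMachine

/-- The class `CL` of the real-time log-space languages over the alphabet `α`. -/
def RealTimeLogSpace (α : Type*) : Set (Language α) :=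
  {L | ∃ M : RealTimeMachine α, M.IsLogSpace ∧ M.language = L}

end

open Asymptotics

/-! ### Rapid convergence -/

/-! As `N → ∞` the network becomes a deterministic automaton in which σ is replaced by its limit
with values 0, 1/2, 1 and tanh by the sign. Plain convergence would not justify this: if a
preactivation `x N` tends to 0, then `N * x N` is uncontrolled. The induction over the word
therefore carries superpolynomial convergence, which survives multiplication by `N` and is
reproduced by saturated gates (`rapidlyTendsto_state`).

In the limit every forget gate is 0 or 1, so each cell is either reset or kept before a half-integer
of size at most 1 is added. After `n` symbols it is `z / 2` with `|z| ≤ 2 * n`, and `h` is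
determined by `z` and one of three output gate values. There are thus only polynomially many states
for a fixed number of units, and `O(log n)` bits suffice (`mem_realTimeLogSpace_of_decode`). -/

/-- `x N` converges to `l` as `N → ∞`, faster than every power of `N`. -/
def RapidlyTendsto (x : ℝ → ℝ) (l : ℝ) : Prop :=
  SuperpolynomialDecay atTop id fun N => x N - l

namespace RapidlyTendsto

variable {x y : ℝ → ℝ} {l m : ℝ}

theorem tendsto (hx : RapidlyTendsto x l) : Tendsto x atTop (𝓝 l) := by
  have h := (hx 0).add_const l
  simpa using h

theorem const (l : ℝ) : RapidlyTendsto (fun _ => l) l := by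
  intro n
  simp

theorem add (hx : RapidlyTendsto x l) (hy : RapidlyTendsto y m) :
    RapidlyTendsto (fun N => x N + y N) (l + m) :=
  (SuperpolynomialDecay.add hx hy).congr fun N => by simp only [Pi.add_apply]; ring

theorem const_mul (c : ℝ) (hx : RapidlyTendsto x l) :
    RapidlyTendsto (fun N => c * x N) (c * l) :=
  (SuperpolynomialDecay.const_mul hx c).congr fun N => by ring

theorem mul (hx : RapidlyTendsto x l) (hy : RapidlyTendsto y m) :
    RapidlyTendsto (fun N => x N * y N) (l * m) :=
  (((SuperpolynomialDecay.mul hx hy).add (SuperpolynomialDecay.const_mul hy l)).add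
    (SuperpolynomialDecay.mul_const hx m)).congr fun N => by
      simp only [Pi.add_apply, Pi.mul_apply]; ring

theorem sum {ι : Type*} (s : Finset ι) {x : ι → ℝ → ℝ} {l : ι → ℝ}
    (h : ∀ i ∈ s, RapidlyTendsto (x i) (l i)) :
    RapidlyTendsto (fun N => ∑ i ∈ s, x i N) (∑ i ∈ s, l i) := by
  classical
  induction s using Finset.induction_on with
  | empty => simpa using const 0
  | insert i s hi ih =>
    simp only [Finset.sum_insert hi]
    exact (h i (Finset.mem_insert_self i s)).add
      (ih fun j hj => h j (Finset.mem_insert_of_mem hj))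

theorem comp_of_abs_sub_le {g : ℝ → ℝ} (hg : ∀ a b, |g a - g b| ≤ |a - b|)
    (hx : RapidlyTendsto x l) : RapidlyTendsto (fun N => g (x N)) (g l) :=
  SuperpolynomialDecay.trans_abs_le hx fun _ => hg _ _

end RapidlyTendsto

/-! ### Saturation of the activation functions -/

theorem abs_sigmoid_sub_le (a b : ℝ) : |Real.sigmoid a - Real.sigmoid b| ≤ |a - b| := by
  have h := Convex.norm_image_sub_le_of_norm_deriv_le (f := Real.sigmoid) (C := 1) (x := b) (y := a)
    (s := Set.univ) (fun x _ => differentiableAt_sigmoid) (fun x _ => by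
      have h0 := Real.sigmoid_pos x
      have h1 := Real.sigmoid_lt_one x
      rw [Real.deriv_sigmoid, Real.norm_eq_abs, abs_le]
      constructor <;> nlinarith) convex_univ trivial trivial
  simpa using h

theorem tanh_eq_two_mul_sigmoid_sub_one (x : ℝ) :
    Real.tanh x = 2 * Real.sigmoid (2 * x) - 1 := by
  have h1 : Real.exp (-(2 * x)) = Real.exp (-x) * Real.exp (-x) := by
    rw [← Real.exp_add]; ring_nf
  have h2 : Real.exp x * Real.exp (-x) = 1 := by
    rw [← Real.exp_add]; simp
  have h3 := Real.exp_pos x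
  have h4 := Real.exp_pos (-x)
  rw [Real.tanh_eq_sinh_div_cosh, Real.sinh_eq, Real.cosh_eq, Real.sigmoid_def, h1]
  field_simp
  linear_combination (2 * Real.exp (-x)) * h2

theorem abs_tanh_sub_le (a b : ℝ) : |Real.tanh a - Real.tanh b| ≤ |a - b| := by
  have h := Convex.norm_image_sub_le_of_norm_deriv_le (f := Real.tanh) (C := 1) (x := b) (y := a)
    (s := Set.univ) (fun x _ => ?_) (fun x _ => ?_) convex_univ trivial trivial
  · simpa using h
  all_goals
    have hd : HasDerivAt Real.tanh
        (2 * (Real.sigmoid (2 * x) * (1 - Real.sigmoid (2 * x)) * 2)) x := by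
      have h := (((Real.hasDerivAt_sigmoid (2 * x)).comp x
        ((hasDerivAt_id x).const_mul 2)).const_mul 2).sub_const 1
      rw [show Real.tanh = fun x => 2 * Real.sigmoid (2 * x) - 1 from
        funext tanh_eq_two_mul_sigmoid_sub_one]
      simpa using! h
  · exact hd.differentiableAt
  · rw [hd.deriv, Real.norm_eq_abs, abs_le]
    have h0 := Real.sigmoid_pos (2 * x)
    have h1 := Real.sigmoid_lt_one (2 * x)
    -- With `s = σ(2x)` the derivative is `4s(1 - s) = 1 - (1 - 2s)²`.
    constructor <;> nlinarith [sq_nonneg (1 - 2 * Real.sigmoid (2 * x))]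

theorem CellActivation.abs_toFun_sub_le (f : CellActivation) (a b : ℝ) :
    |f.toFun a - f.toFun b| ≤ |a - b| := by
  cases f
  · exact le_rfl
  · exact abs_tanh_sub_le a b

/-- The pointwise limit of `x ↦ σ (N x)` as `N → ∞`. -/
noncomputable def saturatedSigmoid (x : ℝ) : ℝ := (1 + Real.sign x) / 2

/-- The error is `σ(-N x) ≤ exp(-N x)`, and eventually `x N > l / 2`, so it decays exponentially. -/
theorem RapidlyTendsto.sigmoid_of_pos {x : ℝ → ℝ} {l : ℝ} (hx : RapidlyTendsto x l) (hl : 0 < l) :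
    RapidlyTendsto (fun N => Real.sigmoid (N * x N)) 1 := by
  have hexp : SuperpolynomialDecay atTop id fun N : ℝ => Real.exp (-(l / 2) * N) := fun n => by
    simpa using tendsto_rpow_mul_exp_neg_mul_atTop_nhds_zero n (l / 2) (half_pos hl)
  refine hexp.trans_eventually_abs_le ?_
  filter_upwards [hx.tendsto.eventually_const_lt (half_lt_self hl), eventually_ge_atTop 0]
    with N hN hN0
  have h : Real.sigmoid (N * x N) - 1 = -Real.sigmoid (-(N * x N)) := by
    rw [Real.sigmoid_neg]; ring
  simp only [Function.comp_apply]
  rw [h, abs_neg, abs_of_pos (Real.sigmoid_pos _), abs_of_pos (Real.exp_pos _),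
    ← Real.sigmoid_mul_rexp_neg]
  calc Real.sigmoid (N * x N) * Real.exp (-(N * x N))
      ≤ 1 * Real.exp (-(N * x N)) := by gcongr; exact Real.sigmoid_le_one _
    _ ≤ Real.exp (-(l / 2) * N) := by
      rw [one_mul, Real.exp_le_exp]; nlinarith

theorem RapidlyTendsto.sigmoid {x : ℝ → ℝ} {l : ℝ} (hx : RapidlyTendsto x l) :
    RapidlyTendsto (fun N => Real.sigmoid (N * x N)) (saturatedSigmoid l) := by
  rcases lt_trichotomy l 0 with hl | rfl | hl
  · have h := ((hx.const_mul (-1)).sigmoid_of_pos (by linarith)).const_mul (-1)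
    have h' := (RapidlyTendsto.const 1).add h
    rw [saturatedSigmoid, Real.sign_of_neg hl]
    convert h' using 1
    · funext N
      rw [show N * (-1 * x N) = -(N * x N) by ring, Real.sigmoid_neg]; ring
    · norm_num
  -- The critical case: superpolynomial decay absorbs the factor `N`, and σ is 1-Lipschitz, so the
  -- limit is `σ(0) = 1/2`.
  · have h : RapidlyTendsto (fun N => N * x N) 0 :=
      (SuperpolynomialDecay.param_mul hx).congr fun N => by simp
    have h' := h.comp_of_abs_sub_le abs_sigmoid_sub_le
    rw [saturatedSigmoid, Real.sign_zero]
    simpa using h'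
  · rw [saturatedSigmoid, Real.sign_of_pos hl]
    norm_num
    exact hx.sigmoid_of_pos hl

theorem RapidlyTendsto.tanh {x : ℝ → ℝ} {l : ℝ} (hx : RapidlyTendsto x l) :
    RapidlyTendsto (fun N => Real.tanh (N * x N)) (Real.sign l) := by
  have h := ((hx.const_mul 2).sigmoid.const_mul 2).add (RapidlyTendsto.const (-1))
  convert h using 1
  · funext N
    rw [tanh_eq_two_mul_sigmoid_sub_one, show N * (2 * x N) = 2 * (N * x N) by ring]; ring
  · have hs : Real.sign (2 * l) = Real.sign l := by
      rcases lt_trichotomy l 0 with hl | rfl | hl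
      · rw [Real.sign_of_neg hl, Real.sign_of_neg (by linarith)]
      · simp
      · rw [Real.sign_of_pos hl, Real.sign_of_pos (by linarith)]
    rw [saturatedSigmoid, hs]; ring

/-! ### The saturated LSTM -/

theorem AffineWeights.eval_scale {α : Type*} [Fintype α] {k : ℕ} (A : AffineWeights α k) (N : ℝ)
    (x : α → ℝ) (h : Fin k → ℝ) : (A.scale N).eval x h = N • A.eval x h := by
  simp [AffineWeights.eval, AffineWeights.scale, Matrix.smul_mulVec]

theorem AffineWeights.rapidlyTendsto_eval {α : Type*} [Fintype α] {k : ℕ} (A : AffineWeights α k)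
    (x : α → ℝ) {h : ℝ → Fin k → ℝ} {l : Fin k → ℝ}
    (hl : ∀ j, RapidlyTendsto (fun N => h N j) (l j)) (j : Fin k) :
    RapidlyTendsto (fun N => A.eval x (h N) j) (A.eval x l j) := by
  simp only [AffineWeights.eval, Pi.add_apply, Matrix.mulVec, dotProduct]
  exact ((RapidlyTendsto.const _).add
    (RapidlyTendsto.sum _ fun i _ => (hl i).const_mul _)).add (RapidlyTendsto.const _)

namespace LSTMWeights

variable {α : Type*} [Fintype α] [DecidableEq α] {k : ℕ}

/-- The limit as `N → ∞` of the cell state that parameters `N θ` compute in one step. -/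
noncomputable def saturatedCell (θ : LSTMWeights α k) (s : LSTMState k) (a : α) : Fin k → ℝ := fun j =>
  saturatedSigmoid (θ.forget.eval (Pi.single a 1) s.h j) * s.c j +
    saturatedSigmoid (θ.input.eval (Pi.single a 1) s.h j) *
      Real.sign (θ.candidate.eval (Pi.single a 1) s.h j)

/-- The limit of the step function with parameters `N θ` as `N → ∞`. -/
noncomputable def saturatedStep (f : CellActivation) (θ : LSTMWeights α k) (s : LSTMState k) (a : α) :
    LSTMState k where
  c := θ.saturatedCell s a
  h := fun j => saturatedSigmoid (θ.output.eval (Pi.single a 1) s.h j) *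
    f.toFun (θ.saturatedCell s a j)

/-- The limit of the state after the word `w` with parameters `N θ` as `N → ∞`. -/
noncomputable def saturatedState (f : CellActivation) (θ : LSTMWeights α k) (w : List α) : LSTMState k :=
  w.foldl (θ.saturatedStep f) ⟨0, 0⟩

theorem state_append_singleton (f : CellActivation) (θ : LSTMWeights α k) (w : List α) (a : α) :
    θ.state f (w ++ [a]) = θ.step f (θ.state f w) a := by
  simp [state]

theorem saturatedState_append_singleton (f : CellActivation) (θ : LSTMWeights α k) (w : List α)
    (a : α) : θ.saturatedState f (w ++ [a]) = θ.saturatedStep f (θ.saturatedState f w) a := by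
  simp [saturatedState]

variable {f : CellActivation} {θ : LSTMWeights α k}

theorem rapidlyTendsto_forgetGate {h : ℝ → Fin k → ℝ} {l : Fin k → ℝ}
    (hl : ∀ j, RapidlyTendsto (fun N => h N j) (l j)) (a : α) (j : Fin k) :
    RapidlyTendsto (fun N => (θ.scale N).forgetGate (h N) a j)
      (saturatedSigmoid (θ.forget.eval (Pi.single a 1) l j)) := by
  simp only [forgetGate, scale, AffineWeights.eval_scale, Pi.smul_apply, smul_eq_mul]
  exact (θ.forget.rapidlyTendsto_eval _ hl j).sigmoid

theorem rapidlyTendsto_nextCell {s : ℝ → LSTMState k} {t : LSTMState k}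
    (hc : ∀ j, RapidlyTendsto (fun N => (s N).c j) (t.c j))
    (hh : ∀ j, RapidlyTendsto (fun N => (s N).h j) (t.h j)) (a : α) (j : Fin k) :
    RapidlyTendsto (fun N => (θ.scale N).nextCell (s N) a j) (θ.saturatedCell t a j) := by
  refine ((rapidlyTendsto_forgetGate hh a j).mul (hc j)).add (RapidlyTendsto.mul ?_ ?_)
  · simp only [inputGate, scale, AffineWeights.eval_scale, Pi.smul_apply, smul_eq_mul]
    exact (θ.input.rapidlyTendsto_eval _ hh j).sigmoid
  · simp only [candidateUpdate, scale, AffineWeights.eval_scale, Pi.smul_apply, smul_eq_mul]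
    exact (θ.candidate.rapidlyTendsto_eval _ hh j).tanh

theorem rapidlyTendsto_state (f : CellActivation) (θ : LSTMWeights α k) (w : List α) :
    (∀ j, RapidlyTendsto (fun N => ((θ.scale N).state f w).c j) ((θ.saturatedState f w).c j)) ∧
      ∀ j, RapidlyTendsto (fun N => ((θ.scale N).state f w).h j) ((θ.saturatedState f w).h j) := by
  induction w using List.reverseRecOn with
  | nil => exact ⟨fun j => RapidlyTendsto.const 0, fun j => RapidlyTendsto.const 0⟩
  | append_singleton w a ih =>
    simp only [state_append_singleton, saturatedState_append_singleton]
    refine ⟨rapidlyTendsto_nextCell ih.1 ih.2 a, fun j => RapidlyTendsto.mul ?_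
      ((rapidlyTendsto_nextCell ih.1 ih.2 a j).comp_of_abs_sub_le f.abs_toFun_sub_le)⟩
    simp only [outputGate, scale, AffineWeights.eval_scale, Pi.smul_apply, smul_eq_mul]
    exact (θ.output.rapidlyTendsto_eval _ ih.2 j).sigmoid

theorem tendsto_prob (f : CellActivation) (θ : LSTMWeights α k) (w : List α) :
    Tendsto (fun N : ℝ => (θ.scale N).prob f w) atTop
      (𝓝 (saturatedSigmoid (dotProduct θ.headW (θ.saturatedState f w).h + θ.headB))) := by
  have h : RapidlyTendsto
      (fun N => dotProduct θ.headW ((θ.scale N).state f w).h + θ.headB)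
      (dotProduct θ.headW (θ.saturatedState f w).h + θ.headB) :=
    (RapidlyTendsto.sum _ fun i _ => ((rapidlyTendsto_state f θ w).2 i).const_mul _).add
      (RapidlyTendsto.const _)
  refine h.sigmoid.tendsto.congr fun N => ?_
  simp only [prob]
  congr 1
  simp only [scale, smul_dotProduct, smul_eq_mul]
  ring

theorem AsymptoticallyAccepts.mem_iff {L : Language α} (hL : θ.AsymptoticallyAccepts f L)
    (w : List α) :
    w ∈ L ↔ saturatedSigmoid (dotProduct θ.headW (θ.saturatedState f w).h + θ.headB) = 1 := by
  rw [tendsto_nhds_unique (tendsto_prob f θ w) (hL w)]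
  by_cases h : w ∈ L <;> simp [h]

/-- The gate converges to its saturated value, so the value 1/2 would contradict the hypothesis. -/
theorem ForgetGatesDecided.saturatedSigmoid_eq (hθ : θ.ForgetGatesDecided f) (w : List α) (a : α)
    (j : Fin k) :
    saturatedSigmoid (θ.forget.eval (Pi.single a 1) (θ.saturatedState f w).h j) = 0 ∨
      saturatedSigmoid (θ.forget.eval (Pi.single a 1) (θ.saturatedState f w).h j) = 1 := by
  have h := hθ w a j
  have h' := (rapidlyTendsto_forgetGate (θ := θ) (rapidlyTendsto_state f θ w).2 a j).tendsto
  simp only [saturatedSigmoid] at h' ⊢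
  rcases Real.sign_apply_eq (θ.forget.eval (Pi.single a 1) (θ.saturatedState f w).h j)
    with hs | hs | hs
  · rw [hs]; norm_num
  · rw [hs] at h'; norm_num at h' h; exact absurd h' h
  · rw [hs]; norm_num

end LSTMWeights

/-! ### Half-integrality of the saturated state -/

theorem exists_saturatedSigmoid_eq (x : ℝ) : ∃ o : ℕ, o ≤ 2 ∧ saturatedSigmoid x = o / 2 := by
  unfold saturatedSigmoid
  rcases Real.sign_apply_eq x with hs | hs | hs
  · exact ⟨0, by norm_num, by rw [hs]; norm_num⟩
  · exact ⟨1, by norm_num, by rw [hs]; norm_num⟩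
  · exact ⟨2, by norm_num, by rw [hs]; norm_num⟩

theorem exists_saturatedSigmoid_mul_sign_eq (x y : ℝ) :
    ∃ z : ℤ, |z| ≤ 2 ∧ saturatedSigmoid x * Real.sign y = z / 2 := by
  obtain ⟨o, ho, h⟩ := exists_saturatedSigmoid_eq x
  rw [h]
  rcases Real.sign_apply_eq y with hs | hs | hs
  · exact ⟨-o, by rw [abs_neg, Nat.abs_cast]; exact_mod_cast ho, by rw [hs]; push_cast; ring⟩
  · exact ⟨0, by norm_num, by rw [hs]; simp⟩
  · exact ⟨o, by rw [Nat.abs_cast]; exact_mod_cast ho, by rw [hs]; push_cast; ring⟩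

namespace LSTMWeights

variable {α : Type*} [Fintype α] [DecidableEq α] {k : ℕ} {f : CellActivation}
  {θ : LSTMWeights α k}

/-- The saturated state is described by polynomially bounded integers. -/
theorem ForgetGatesDecided.exists_saturatedState_eq (hθ : θ.ForgetGatesDecided f) (w : List α)
    (j : Fin k) : ∃ (z : ℤ) (o : ℕ), |z| ≤ 2 * w.length ∧ o ≤ 2 ∧
      (θ.saturatedState f w).c j = z / 2 ∧
      (θ.saturatedState f w).h j = o / 2 * f.toFun (z / 2) := by
  induction w using List.reverseRecOn with
  | nil => exact ⟨0, 0, by simp, by simp, by simp [saturatedState], by simp [saturatedState]⟩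
  | append_singleton w a ih =>
    obtain ⟨z, -, hz, -, hc, -⟩ := ih
    obtain ⟨y, hy, hyc⟩ := exists_saturatedSigmoid_mul_sign_eq
      (θ.input.eval (Pi.single a 1) (θ.saturatedState f w).h j)
      (θ.candidate.eval (Pi.single a 1) (θ.saturatedState f w).h j)
    obtain ⟨o, ho, hoc⟩ := exists_saturatedSigmoid_eq
      (θ.output.eval (Pi.single a 1) (θ.saturatedState f w).h j)
    have key : ∃ z' : ℤ, |z'| ≤ 2 * (w ++ [a]).length ∧
        θ.saturatedCell (θ.saturatedState f w) a j = z' / 2 := by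
      simp only [saturatedCell, hyc, hc, List.length_append, List.length_singleton]
      -- A closed forget gate leaves only the increment `y / 2`; an open one adds it to `z / 2`.
      rcases hθ.saturatedSigmoid_eq w a j with h | h
      · exact ⟨y, by push_cast; linarith [abs_nonneg z], by rw [h]; ring⟩
      · exact ⟨z + y, by push_cast; linarith [abs_add_le z y], by rw [h]; push_cast; ring⟩
    obtain ⟨z', hz', hc'⟩ := key
    refine ⟨z', o, hz', ho, ?_, ?_⟩ <;>
      simp only [saturatedState_append_singleton, saturatedStep, hc', hoc]

end LSTMWeights

/-! ### Codes in logarithmic space -/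

/-- Vectors of `n` natural numbers less than `M` have codes less than a fixed power of `M`. -/
theorem exists_decode_fin (n : ℕ) : ∃ (D : ℕ → Fin n → ℕ) (d : ℕ), ∀ (M : ℕ) (v : Fin n → ℕ),
    0 < M → (∀ i, v i < M) → ∃ m < M ^ d, D m = v := by
  induction n with
  | zero => exact ⟨fun _ => Fin.elim0, 0, fun M v _ _ => ⟨0, by simp, Subsingleton.elim _ _⟩⟩
  | succ n ih =>
    obtain ⟨D, d, hD⟩ := ih
    -- Both components are below `M ^ (d + 1)`, and pairing squares this bound. The decoder does not
    -- depend on `M`.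
    refine ⟨fun m => Fin.cons m.unpair.1 (D m.unpair.2), (d + 1) * 2, fun M v hM hv => ?_⟩
    obtain ⟨m, hm, hmv⟩ := hD M (Fin.tail v) hM fun i => hv i.succ
    refine ⟨Nat.pair (v 0) m, (Nat.pair_lt_max_add_one_sq _ _).trans_le ?_, ?_⟩
    · rw [pow_mul]
      refine Nat.pow_le_pow_left (Nat.succ_le_of_lt (max_lt ?_ ?_)) 2
      · exact (hv 0).trans_le (Nat.le_self_pow (by omega) M)
      · exact hm.trans_le (Nat.pow_le_pow_right hM (by omega))
    · simp [hmv]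

theorem exists_decode (ι : Type*) [Fintype ι] :
    ∃ (D : ℕ → ι → ℕ) (d : ℕ), ∀ (M : ℕ) (v : ι → ℕ),
      0 < M → (∀ i, v i < M) → ∃ m < M ^ d, D m = v := by
  obtain ⟨D, d, hD⟩ := exists_decode_fin (Fintype.card ι)
  let e := Fintype.equivFin ι
  refine ⟨fun m i => D m (e i), d, fun M v hM hv => ?_⟩
  obtain ⟨m, hm, h⟩ := hD M (v ∘ e.symm) hM fun i => hv _
  exact ⟨m, hm, by simp only [h]; funext i; simp⟩

theorem foldr_bit_bits (n : ℕ) : n.bits.foldr Nat.bit 0 = n := by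
  induction n using Nat.binaryRec' with
  | zero => simp
  | bit b n h ih => rw [Nat.bits_append_bit n b h, List.foldr_cons, ih]

/-- A deterministic machine recognizes a real-time log-space language if its states have codes
of logarithmic length. -/
theorem mem_realTimeLogSpace_of_decode {α S : Type*} {L : Language α} (s : List α → S)
    (T : S → α → S) (hs : ∀ w a, s (w ++ [a]) = T (s w) a) (P : Set S)
    (hL : ∀ w, w ∈ L ↔ s w ∈ P) (D : List Bool → S) (C : ℕ)
    (hD : ∀ w, ∃ m, D m = s w ∧ m.length ≤ C * (Nat.log 2 w.length + 1)) :
    L ∈ RealTimeLogSpace α := by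
  classical
  -- The machine does not know the input length, so it stores a shortest code of the state, which is
  -- no longer than the one from `hD`.
  have hcode : ∀ x : S, ∃ m, (∃ m', D m' = x) → D m = x ∧ ∀ m', D m' = x → m.length ≤ m'.length := by
    intro x
    by_cases hx : ∃ m', D m' = x
    · refine ⟨Function.argminOn List.length {m | D m = x} hx, fun _ => ⟨?_, fun m' hm' => ?_⟩⟩
      · exact Function.argminOn_mem List.length {m | D m = x} hx
      · exact Function.argminOn_le List.length {m | D m = x} hm'
    · exact ⟨[], fun h => absurd h hx⟩
  choose code hcode using hcode
  have hcode' : ∀ w, D (code (s w)) = s w := fun w =>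
    (hcode _ ((hD w).imp fun _ h => h.1)).1
  let R : RealTimeMachine α :=
    ⟨code (s []), fun m a => code (T (D m) a), {m | D m ∈ P}⟩
  have hR : ∀ w, R.memory w = code (s w) := fun w => by
    induction w using List.reverseRecOn with
    | nil => rfl
    | append_singleton w a ih =>
      have h : R.memory (w ++ [a]) = code (T (D (R.memory w)) a) := by
        simp [RealTimeMachine.memory, R]
      rw [h, ih, hcode', hs]
  refine ⟨R, ⟨C, fun w => ?_⟩, ?_⟩
  · obtain ⟨m, hm, hlen⟩ := hD w
    rw [hR]
    exact ((hcode _ ⟨m, hm⟩).2 m hm).trans hlen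
  · ext w
    rw [hL]
    change D (R.memory w) ∈ P ↔ _
    rw [hR, hcode']

theorem two_mul_add_three_le_two_pow (n : ℕ) : 2 * n + 3 ≤ 2 ^ (Nat.log 2 n + 3) := by
  have h := Nat.lt_pow_succ_log_self (b := 2) one_lt_two n
  have h1 : 1 ≤ 2 ^ Nat.log 2 n := Nat.one_le_two_pow
  rw [pow_succ] at h
  rw [pow_add]
  omega

/-- **LSTM upper bound.** Every language that is asymptotically accepted by an LSTM acceptor
without asymptotically undecided forget gates is real-time log-space. -/
theorem mainTheorem3 {α : Type*} [Fintype α] [DecidableEq α] {k : ℕ}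
    (f : CellActivation) (θ : LSTMWeights α k) (L : Language α)
    (hL : θ.AsymptoticallyAccepts f L) (hθ : θ.ForgetGatesDecided f) :
    L ∈ RealTimeLogSpace α := by
  obtain ⟨D, d, hD⟩ := exists_decode (Fin k × Fin 3)
  -- Each unit is stored as the positive and negative parts of `z` and the output gate numerator
  -- `o`.
  let toState : (Fin k × Fin 3 → ℕ) → LSTMState k := fun v =>
    ⟨fun j => ((v (j, 0) : ℝ) - v (j, 1)) / 2,
      fun j => v (j, 2) / 2 * f.toFun (((v (j, 0) : ℝ) - v (j, 1)) / 2)⟩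
  refine mem_realTimeLogSpace_of_decode (θ.saturatedState f) (θ.saturatedStep f)
    (LSTMWeights.saturatedState_append_singleton f θ)
    {s | saturatedSigmoid (dotProduct θ.headW s.h + θ.headB) = 1} hL.mem_iff
    (fun m => toState (D (m.foldr Nat.bit 0))) (3 * d) fun w => ?_
  choose z o hz ho hc hh using hθ.exists_saturatedState_eq w
  have hsub : ∀ j, (((z j).toNat : ℝ) - ((-z j).toNat : ℝ)) = z j := fun j => by
    exact_mod_cast Int.toNat_sub_toNat_neg (z j)
  -- The bound exceeds both `2 * w.length` and 2, even for the empty word.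
  obtain ⟨m, hm, hmv⟩ := hD (2 * w.length + 3)
    (fun p => ![(z p.1).toNat, (-z p.1).toNat, o p.1] p.2) (by omega) (by
      rintro ⟨j, i⟩
      have h1 := abs_le.1 (hz j)
      have h2 := ho j
      fin_cases i <;> simp <;> omega)
  refine ⟨m.bits, ?_, ?_⟩
  · have h1 : ∀ j, (θ.saturatedState f w).c j = (toState (D m)).c j := fun j => by
      simp [toState, hmv, hsub, hc]
    have h2 : ∀ j, (θ.saturatedState f w).h j = (toState (D m)).h j := fun j => by
      simp [toState, hmv, hsub, hh]
    rw [foldr_bit_bits]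
    exact LSTMState.mk.injEq .. |>.mpr ⟨funext fun j => (h1 j).symm, funext fun j => (h2 j).symm⟩
  · rw [Nat.size_eq_bits_len, Nat.size_le]
    calc m < (2 * w.length + 3) ^ d := hm
      _ ≤ (2 ^ (Nat.log 2 w.length + 3)) ^ d :=
        Nat.pow_le_pow_left (two_mul_add_three_le_two_pow _) d
      _ = 2 ^ (d * (Nat.log 2 w.length + 3)) := by rw [← pow_mul, mul_comm]
      _ ≤ 2 ^ (3 * d * (Nat.log 2 w.length + 1)) :=
        Nat.pow_le_pow_right (by norm_num) (by nlinarith [Nat.zero_le (d * Nat.log 2 w.length)])
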